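/- Let $n\ge 2$, let $\Omega\subset\mathbb{R}^n$ be a connected bounded open Lipschitz domain, let $0<\underline{\kappa}<\overline{\kappa}<\infty$ and $\overline{\delta}>0$. For $\delta>0$ put $\Omega_\delta=\bigcup_{x\in\Omega}B(x,\delta)$. For each $\delta\in(0,\overline{\delta})$ let $\omega_\delta:\mathbb{R}^n\to[0,\infty)$ be a measurable radial function supported in $B(0,\delta)$ with $$\int_{\mathbb{R}^n}|x|^2\omega_\delta^2(x)\,dx=K_{2,n}^{-1},\qquad K_{2,n}=\frac{1}{|\mathbb{S}^{n-1}|}\int_{\mathbb{S}^{n-1}}|s\cdot e|^2\,ds,$$ where $e$ is any unit vector. For $u\in L^2(\Omega)$, extended by zero outside $\Omega$, let $\mathcal{G}_\delta u(x,x')=[u(x)-u(x')]\,\omega_\delta(x-x')$, regarded as a densely defined unbounded operator from $L^2(\Omega)$ to $L^2(\Omega_\delta\times\Omega_\delta)$ with domain $\{u\in L^2(\Omega):\mathcal{G}_\delta u\in L^2(\Omega_\delta\times\Omega_\delta)\}$. Let $\mathcal{D}_\delta=-\mathcal{G}_\delta^*$ be the negative of its adjoint, and let $\mathbb{Q}_\delta\subset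 L^2(\Omega_\delta\times\Omega_\delta)$ be the domain of $\mathcal{D}_\delta$, with the graph norm $\|\ddot q\|_{\mathbb{Q}_\delta}^2=\|\ddot q\|_{L^2(\Omega_\delta\times\Omega_\delta)}^2+\|\mathcal{D}_\delta\ddot q\|_{L^2(\Omega)}^2$. Then there is a constant $C>0$, depending only on $n$, $\Omega$, $\underline{\kappa}$, $\overline{\kappa}$, $\overline{\delta}$ and the family $(\omega_\delta)_{0<\delta<\overline{\delta}}$, such that the following holds for every $\delta\in(0,\overline{\delta})$, every measurable $\ddot\kappa:\Omega_\delta\times\Omega_\delta\to\mathbb{R}$ with $\ddot\kappa(x,x')=\ddot\kappa(x',x)$ and $\underline{\kappa}\le\ddot\kappa(x,x')\le\overline{\kappa}$ for almost all $(x,x')$ (for example, the harmonic average $\ddot\kappa(x,x')=2\kappa(x)\kappa(x')/[\kappa(x)+\kappa(x')]$ of a measurable $\kappa:\Omega_\delta\to[\underline{\kappa},\overline{\kappa}]$), and every $f\in L^2(\Omega)$. The nonlocal mixed (Kelvin) problem $$\begin{aligned}\int_{\Omega_\delta}\int_{\Omega_\delta}\ddot\kappa^{-1}(x,x')\,\ddot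 q(x,x')\,\ddot p(x,x')\,dx\,dx'-\int_\Omega \mathcal{D}_\delta\ddot p(x)\,u(x)\,dx&=0 &&\forall\,\ddot p\in\mathbb{Q}_\delta,\\ -\int_\Omega\mathcal{D}_\delta\ddot q(x)\,v(x)\,dx&=-\int_\Omega f(x)\,v(x)\,dx &&\forall\, v\in L^2(\Omega)\end{aligned}$$ has a unique solution $(\ddot q,u)\in\mathbb{Q}_\delta\times L^2(\Omega)$, and this solution satisfies $$\|\ddot q\|_{\mathbb{Q}_\delta}+\|u\|_{L^2(\Omega)}\le C\,\|f\|_{L^2(\Omega)}.$$ -/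

import Mathlib

open MeasureTheory Set

namespace NonlocalKelvin

noncomputable section

/-- Euclidean space of dimension `n`. -/
abbrev E (n : ℕ) : Type := EuclideanSpace ℝ (Fin n)

/-- Lipschitz boundary: near each boundary point, `Ω` is the strict supergraph, in some unit
direction `e`, of a Lipschitz function of the component orthogonal to `e`. -/
def HasLipschitzBoundary {n : ℕ} (Ω : Set (E n)) : Prop :=
  ∀ a ∈ frontier Ω, ∃ e : E n, ‖e‖ = 1 ∧ ∃ (L : NNReal) (g : E n → ℝ), LipschitzWith L g ∧
    ∃ r : ℝ, 0 < r ∧ ∀ x ∈ Metric.ball a r,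
      (x ∈ Ω ↔ g (x - inner ℝ e x • e) < inner ℝ e x)

/-- A connected (in particular nonempty) bounded open Lipschitz domain. -/
structure IsLipschitzDomain {n : ℕ} (Ω : Set (E n)) : Prop where
  isOpen : IsOpen Ω
  isConnected : IsConnected Ω
  isBounded : Bornology.IsBounded Ω
  lipschitz : HasLipschitzBoundary Ω

/-- `K_{2,n}`: the mean value of `|s · e|²` over the unit sphere, with respect to surface measure
(it does not depend on the unit vector `e`). -/
def sphereMoment {n : ℕ} (e : E n) : ℝ :=
  ⨍ s : Metric.sphere (0 : E n) 1, |inner ℝ (s : E n) e| ^ 2 ∂((volume : Measure (E n)).toSphere)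

/-- Interaction kernel of horizon `δ`: a nonnegative radial function supported in `B(0, δ)` with
`∫ |x|² ω(x)² dx = K_{2,n}⁻¹`. -/
structure IsKernel {n : ℕ} (δ : ℝ) (ω : E n → ℝ) : Prop where
  measurable : Measurable ω
  nonneg : ∀ x, 0 ≤ ω x
  radial : ∀ x y, ‖x‖ = ‖y‖ → ω x = ω y
  support_subset : Function.support ω ⊆ Metric.ball 0 δ
  integrable : Integrable (fun x => ‖x‖ ^ 2 * ω x ^ 2)
  normalized : ∀ e : E n, ‖e‖ = 1 → ∫ x, ‖x‖ ^ 2 * ω x ^ 2 = (sphereMoment e)⁻¹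

/-- `Ω_δ`, the union of the balls `B(x, δ)` with `x ∈ Ω`. -/
abbrev extDomain {n : ℕ} (Ω : Set (E n)) (δ : ℝ) : Set (E n) := Metric.thickening δ Ω

/-- Lebesgue measure on `Ω_δ × Ω_δ`. -/
def pairMeasure {n : ℕ} (Ω : Set (E n)) (δ : ℝ) : Measure (E n × E n) :=
  (volume.restrict (extDomain Ω δ)).prod (volume.restrict (extDomain Ω δ))

/-- `L²(Ω)`. -/
abbrev L2 {n : ℕ} (Ω : Set (E n)) : Type := Lp ℝ 2 (volume.restrict Ω)

/-- `L²(Ω_δ × Ω_δ)`. -/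
abbrev L2Pair {n : ℕ} (Ω : Set (E n)) (δ : ℝ) : Type := Lp ℝ 2 (pairMeasure Ω δ)

/-- `(x, x') ↦ [u(x) - u(x')] ω(x - x')`, where `u` is extended by zero outside `Ω`. -/
def gradFun {n : ℕ} (Ω : Set (E n)) (ω : E n → ℝ) (u : E n → ℝ) : E n × E n → ℝ :=
  fun z => (Ω.indicator u z.1 - Ω.indicator u z.2) * ω (z.1 - z.2)

theorem gradFun_congr {n : ℕ} {Ω : Set (E n)} (δ : ℝ) (ω : E n → ℝ) {u v : E n → ℝ}
    (h : u =ᵐ[volume.restrict Ω] v) : gradFun Ω ω u =ᵐ[pairMeasure Ω δ] gradFun Ω ω v := by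
  have h0 : Ω.indicator u =ᵐ[volume] Ω.indicator v := by
    filter_upwards [ae_imp_of_ae_restrict h] with x hx
    by_cases hxΩ : x ∈ Ω
    · simp [hxΩ, hx hxΩ]
    · simp [hxΩ]
  have h1 : Ω.indicator u =ᵐ[volume.restrict (extDomain Ω δ)] Ω.indicator v :=
    ae_restrict_of_ae h0
  have h2 := (Measure.quasiMeasurePreserving_fst (μ := volume.restrict (extDomain Ω δ))
    (ν := volume.restrict (extDomain Ω δ))).ae_eq h1
  have h3 := (Measure.quasiMeasurePreserving_snd (μ := volume.restrict (extDomain Ω δ))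
    (ν := volume.restrict (extDomain Ω δ))).ae_eq h1
  unfold pairMeasure
  filter_upwards [h2, h3] with z hz hz'
  simp only [Function.comp_apply] at hz hz'
  simp only [gradFun, hz, hz']

theorem gradFun_add_ae {n : ℕ} {Ω : Set (E n)} (δ : ℝ) (ω : E n → ℝ) (u v : L2 Ω) :
    gradFun Ω ω (u + v : L2 Ω) =ᵐ[pairMeasure Ω δ] gradFun Ω ω u + gradFun Ω ω v := by
  refine (gradFun_congr δ ω (Lp.coeFn_add u v)).trans (Filter.EventuallyEq.of_eq ?_)
  funext z
  simp only [gradFun, indicator_add', Pi.add_apply]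
  ring

theorem gradFun_smul_ae {n : ℕ} {Ω : Set (E n)} (δ : ℝ) (ω : E n → ℝ) (c : ℝ) (u : L2 Ω) :
    gradFun Ω ω (c • u : L2 Ω) =ᵐ[pairMeasure Ω δ] c • gradFun Ω ω u := by
  refine (gradFun_congr δ ω (Lp.coeFn_smul c u)).trans (Filter.EventuallyEq.of_eq ?_)
  funext z
  simp only [gradFun, Pi.smul_apply, smul_eq_mul]
  by_cases h1 : z.1 ∈ Ω <;> by_cases h2 : z.2 ∈ Ω <;> simp [h1, h2] <;> ring

theorem gradFun_zero_ae {n : ℕ} {Ω : Set (E n)} (δ : ℝ) (ω : E n → ℝ) :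
    gradFun Ω ω (0 : L2 Ω) =ᵐ[pairMeasure Ω δ] 0 := by
  refine (gradFun_congr δ ω (Lp.coeFn_zero ℝ 2 _)).trans (Filter.EventuallyEq.of_eq ?_)
  funext z
  simp [gradFun]

/-- The domain `{u ∈ L²(Ω) | G_δ u ∈ L²(Ω_δ × Ω_δ)}` of the nonlocal gradient. -/
def gradDomain {n : ℕ} (Ω : Set (E n)) (δ : ℝ) (ω : E n → ℝ) : Submodule ℝ (L2 Ω) where
  carrier := {u | MemLp (gradFun Ω ω u) 2 (pairMeasure Ω δ)}
  zero_mem' := (memLp_congr_ae (gradFun_zero_ae δ ω)).2 MemLp.zero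
  add_mem' := fun {u v} hu hv =>
    (memLp_congr_ae (gradFun_add_ae δ ω u v)).2 (MemLp.add hu hv)
  smul_mem' := fun c u hu =>
    (memLp_congr_ae (gradFun_smul_ae δ ω c u)).2 (MemLp.const_smul hu c)

theorem mem_gradDomain {n : ℕ} {Ω : Set (E n)} {δ : ℝ} {ω : E n → ℝ} {u : L2 Ω} :
    u ∈ gradDomain Ω δ ω ↔ MemLp (gradFun Ω ω u) 2 (pairMeasure Ω δ) := Iff.rfl

/-- The nonlocal gradient `G_δ`, as an unbounded operator from `L²(Ω)` to `L²(Ω_δ × Ω_δ)`. -/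
def nlGrad {n : ℕ} (Ω : Set (E n)) (δ : ℝ) (ω : E n → ℝ) : L2 Ω →ₗ.[ℝ] L2Pair Ω δ where
  domain := gradDomain Ω δ ω
  toFun :=
    { toFun := fun u => MemLp.toLp (gradFun Ω ω (u : L2 Ω)) (mem_gradDomain.1 u.2)
      map_add' := fun u v =>
        (MemLp.toLp_congr _ ((mem_gradDomain.1 u.2).add (mem_gradDomain.1 v.2))
          (gradFun_add_ae δ ω (u : L2 Ω) (v : L2 Ω))).trans
          (MemLp.toLp_add (mem_gradDomain.1 u.2) (mem_gradDomain.1 v.2))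
      map_smul' := fun c u =>
        (MemLp.toLp_congr _ ((mem_gradDomain.1 u.2).const_smul c)
          (gradFun_smul_ae δ ω c (u : L2 Ω))).trans
          (MemLp.toLp_const_smul c (mem_gradDomain.1 u.2)) }

/-- The nonlocal divergence `D_δ`: the negative of the (Hilbert space) adjoint of `G_δ`. -/
def nlDiv {n : ℕ} (Ω : Set (E n)) (δ : ℝ) (ω : E n → ℝ) : L2Pair Ω δ →ₗ.[ℝ] L2 Ω :=
  -(nlGrad Ω δ ω).adjoint

/-- The flux space `Q_δ`, the domain of `D_δ`. -/
abbrev FluxSpace {n : ℕ} (Ω : Set (E n)) (δ : ℝ) (ω : E n → ℝ) : Type :=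
  (nlDiv Ω δ ω).domain

/-- The graph norm of `Q_δ`. -/
def fluxNorm {n : ℕ} {Ω : Set (E n)} {δ : ℝ} {ω : E n → ℝ} (q : FluxSpace Ω δ ω) : ℝ :=
  Real.sqrt (‖(q : L2Pair Ω δ)‖ ^ 2 + ‖nlDiv Ω δ ω q‖ ^ 2)

/-- Two-point conductivities: measurable, symmetric, with values in `[κlo, κhi]`, almost everywhere
on `Ω_δ × Ω_δ`. -/
structure IsConductivity {n : ℕ} (Ω : Set (E n)) (δ κlo κhi : ℝ) (κ : E n × E n → ℝ) : Prop where
  aemeasurable : AEMeasurable κ (pairMeasure Ω δ)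
  symm : ∀ᵐ z ∂(pairMeasure Ω δ), κ z = κ z.swap
  mem_Icc : ∀ᵐ z ∂(pairMeasure Ω δ), κ z ∈ Icc κlo κhi

/-- `a(κ; q, p) = ∬ κ⁻¹ q p`. -/
def formA {n : ℕ} {Ω : Set (E n)} {δ : ℝ} {ω : E n → ℝ} (κ : E n × E n → ℝ)
    (q p : FluxSpace Ω δ ω) : ℝ :=
  ∫ z, (κ z)⁻¹ * (q : L2Pair Ω δ) z * (p : L2Pair Ω δ) z ∂(pairMeasure Ω δ)

/-- `b(p, v) = -∫_Ω (D_δ p) v`. -/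
def formB {n : ℕ} {Ω : Set (E n)} {δ : ℝ} {ω : E n → ℝ} (p : FluxSpace Ω δ ω) (v : L2 Ω) : ℝ :=
  -∫ x in Ω, nlDiv Ω δ ω p x * v x

/-- `ℓ(v) = ∫_Ω f v`. -/
def load {n : ℕ} {Ω : Set (E n)} (f v : L2 Ω) : ℝ := ∫ x in Ω, f x * v x

/-- `(q, u)` solves the nonlocal mixed (Kelvin) problem with conductivity `κ` and source `f`. -/
def IsMixedSolution {n : ℕ} {Ω : Set (E n)} {δ : ℝ} {ω : E n → ℝ} (κ : E n × E n → ℝ)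
    (f : L2 Ω) (s : FluxSpace Ω δ ω × L2 Ω) : Prop :=
  (∀ p : FluxSpace Ω δ ω, formA κ s.1 p + formB p s.2 = 0) ∧
    ∀ v : L2 Ω, formB s.1 v = -load f v

end

end NonlocalKelvin

/-!
The problem is reduced to a Poincaré inequality `‖u‖ ≤ c ‖G_δ u‖` with `c` independent of `δ`.

*Poincaré inequality* (`norm_le_mul_norm_nlGrad`). Extend `u` by zero and let
`N(h) = ‖u(· + h) - u‖` in `L²(ℝⁿ)`. The triangle inequality gives `N(kh) ≤ k N(h)` for natural
numbers `k`. If `‖kh‖` exceeds the diameter `R` of `Ω`, then `Ω` and its translate by `kh` are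
disjoint, so `‖u‖ ≤ N(kh)`. Taking the least such `k` yields `‖h‖ ‖u‖ ≤ (R + ‖h‖) N(h)`. Since
`‖G_δ u‖² = ∫ ω(h)² N(h)² dh` (`sq_eLpNorm_gradFun`), squaring and integrating against `ω²` bounds
`(∫ ‖h‖² ω²) ‖u‖²` by `(R + δ)² ‖G_δ u‖²`, and the normalization of the kernel says precisely that
the first factor is `n` (`IsKernel.integral_norm_sq_mul_sq`).

*Well-posedness* (`exists_unique_mixedSolution`). `G_δ` is densely defined, because Lipschitz
functions supported in `Ω` have finite energy (`dense_gradDomain`), so `D_δ` is a genuine adjoint.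
A solution is `q = -κ G_δ u`, where `G_δ* (κ G_δ u) = f` is solved by Lax–Milgram in the closure of
the range of `G_δ` (`exists_solution_of_poincare`). For uniqueness, the difference of two solutions
is divergence free, so testing with the difference of the fluxes shows that these agree; the
potentials then agree because `D_δ` is onto.
-/

namespace NonlocalKelvin

/-! ### Coercive problems for a densely defined operator with a Poincaré inequality -/

/-- Solvability of `G* A G u = f` when `‖u‖ ≤ c ‖G u‖` on the domain of `G` and `A` is coercive.
`G` need not be closed: `g` lies in the closure of the range of `G`, where Lax–Milgram applies, and
`u` is the image of `g` under the continuous extension of `G⁻¹` to that closure, so that `g` plays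
the part of `G u`. -/
theorem exists_solution_of_poincare {H K : Type*}
    [NormedAddCommGroup H] [InnerProductSpace ℝ H] [CompleteSpace H]
    [NormedAddCommGroup K] [InnerProductSpace ℝ K] [CompleteSpace K]
    (G : H →ₗ.[ℝ] K) (hG : Dense (G.domain : Set H)) {c : ℝ} (hc : 0 ≤ c)
    (hP : ∀ u : G.domain, ‖(u : H)‖ ≤ c * ‖G u‖)
    (A : K →L[ℝ] K) {α : ℝ} (hα : 0 < α) (hA : ∀ g, α * ‖g‖ ^ 2 ≤ inner ℝ (A g) g) (f : H) :
    ∃ (g : K) (u : H), (∀ v : G.domain, inner ℝ (A g) (G v) = inner ℝ f (v : H)) ∧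
      (∀ p : G.adjoint.domain, inner ℝ (p : K) g = inner ℝ (G.adjoint p) u) ∧
      ‖u‖ ≤ c * ‖g‖ ∧ α * ‖g‖ ≤ c * ‖f‖ := by
  set M : Submodule ℝ K := (LinearMap.range G.toFun).topologicalClosure with hM
  have hmem : ∀ v : G.domain, G v ∈ M := fun v =>
    Submodule.le_topologicalClosure _ ⟨v, rfl⟩
  let e : G.domain →ₗ[ℝ] M := G.toFun.codRestrict M hmem
  have he : ∀ v : G.domain, (e v : K) = G v := fun v => rfl
  have hMcl : IsClosed (M : Set K) := Submodule.isClosed_topologicalClosure _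
  have : CompleteSpace M := hMcl.completeSpace_coe
  have hdense : DenseRange e := by
    intro m
    have hm : (m : K) ∈ closure (LinearMap.range G.toFun : Set K) := m.2
    rw [closure_subtype]
    refine closure_mono ?_ hm
    rintro _ ⟨v, rfl⟩
    exact ⟨e v, ⟨v, rfl⟩, rfl⟩
  let T : M →L[ℝ] H := G.domain.subtype.extendOfNorm e
  have hT : ∀ v : G.domain, T (e v) = v := fun v =>
    LinearMap.extendOfNorm_eq hdense ⟨c, hP⟩ v
  have hTn : ∀ m : M, ‖T m‖ ≤ c * ‖m‖ := fun m =>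
    LinearMap.norm_extendOfNorm_apply_le hdense c hP m
  let B : M →L[ℝ] M →L[ℝ] ℝ :=
    (isBoundedBilinearMap_inner (𝕜 := ℝ) (E := K)).toContinuousLinearMap.bilinearComp
      (A ∘L M.subtypeL) M.subtypeL
  have hB : ∀ m m' : M, B m m' = inner ℝ (A (m : K)) (m' : K) := fun m m' => rfl
  have hBc : IsCoercive B := ⟨α, hα, fun m => by
    rw [hB]
    have := hA (m : K)
    rw [Submodule.coe_norm]
    nlinarith⟩
  let g : M := hBc.continuousLinearEquivOfBilin.symm (ContinuousLinearMap.adjoint T f)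
  have hg : ∀ m : M, inner ℝ (A (g : K)) (m : K) = inner ℝ f (T m) := fun m => by
    rw [← hB, ← hBc.continuousLinearEquivOfBilin_apply, ContinuousLinearEquiv.apply_symm_apply,
      ContinuousLinearMap.adjoint_inner_left]
  refine ⟨g, T g, fun v => ?_, fun p => ?_, hTn g, ?_⟩
  · rw [← he, hg, hT]
  · refine hdense.induction_on (p := fun m : M => inner ℝ (p : K) (m : K) =
      inner ℝ (G.adjoint p) (T m)) g (isClosed_eq (by fun_prop) (by fun_prop)) fun v => ?_
    rw [hT, he]
    exact (LinearPMap.adjoint_isFormalAdjoint hG p v).symm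
  · have h1 := hA (g : K)
    rw [hg] at h1
    have h2 := real_inner_le_norm f (T g)
    have h3 := mul_le_mul_of_nonneg_left (hTn g) (norm_nonneg f)
    rw [Submodule.coe_norm] at h3
    rcases (norm_nonneg (g : K)).eq_or_lt with h0 | h0
    · rw [← h0, mul_zero]; positivity
    · refine le_of_mul_le_mul_right ?_ h0
      nlinarith
/-! ### The normalization of the kernel -/

/-- The normalization makes the mean of `|s · e|²` independent of the unit vector `e`; averaging
over the coordinate vectors then gives `K_{2,n} = 1 / n`. -/
theorem IsKernel.integral_norm_sq_mul_sq {n : ℕ} (hn : 0 < n) {δ : ℝ} {ω : E n → ℝ}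
    (hω : IsKernel δ ω) : ∫ x, ‖x‖ ^ 2 * ω x ^ 2 = n := by
  have : Nonempty (Fin n) := ⟨⟨0, hn⟩⟩
  have : Nontrivial (E n) := inferInstance
  set μ := (volume : Measure (E n)).toSphere with hμ
  have : NeZero μ := ⟨Measure.toSphere_ne_zero _⟩
  set I := ∫ x, ‖x‖ ^ 2 * ω x ^ 2 with hI
  have hK : ∀ i : Fin n, sphereMoment (EuclideanSpace.single i (1 : ℝ)) = I⁻¹ := fun i => by
    rw [hI, hω.normalized (EuclideanSpace.single i (1 : ℝ)) (by simp), inv_inv]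
  have hint : ∀ i : Fin n, Integrable
      (fun s : Metric.sphere (0 : E n) 1 =>
        |inner ℝ (s : E n) (EuclideanSpace.single i (1 : ℝ))| ^ 2) μ := fun i =>
    Continuous.integrable_of_hasCompactSupport (by fun_prop)
      (HasCompactSupport.of_compactSpace _)
  have hsum : ∑ i : Fin n, sphereMoment (EuclideanSpace.single i (1 : ℝ)) = 1 := by
    simp only [sphereMoment, ← hμ, average_eq]
    rw [← Finset.smul_sum, ← integral_finsetSum _ fun i _ => hint i, ← average_eq]
    have : ∀ s : Metric.sphere (0 : E n) 1,
        ∑ i : Fin n, |inner ℝ (s : E n) (EuclideanSpace.single i (1 : ℝ))| ^ 2 = 1 := fun s => by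
      have h1 : ‖(s : E n)‖ = 1 := by simp
      have h2 := EuclideanSpace.norm_sq_eq (s : E n)
      rw [h1] at h2
      simpa [EuclideanSpace.inner_single_right] using h2.symm
    simp only [this]
    exact average_const μ 1
  simp only [hK, Finset.sum_const, Finset.card_univ, Fintype.card_fin, nsmul_eq_mul] at hsum
  have hI0 : I ≠ 0 := fun h => by simp [h] at hsum
  field_simp at hsum
  exact hsum.symm

theorem IsKernel.lintegral_enorm_sq_mul_sq {n : ℕ} (hn : 0 < n) {δ : ℝ} {ω : E n → ℝ}
    (hω : IsKernel δ ω) : ∫⁻ x, ‖x‖ₑ ^ 2 * ‖ω x‖ₑ ^ 2 = n := by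
  have h := ofReal_integral_eq_lintegral_ofReal hω.integrable
    (Filter.Eventually.of_forall fun x => by positivity)
  rw [hω.integral_norm_sq_mul_sq hn, ENNReal.ofReal_natCast] at h
  rw [h]
  refine lintegral_congr fun x => ?_
  rw [ENNReal.ofReal_mul (by positivity), ENNReal.ofReal_pow (norm_nonneg _), ofReal_norm,
    ENNReal.ofReal_pow (hω.nonneg x), ← Real.enorm_of_nonneg (hω.nonneg x)]

/-! ### The nonlocal energy -/

theorem sq_eLpNorm_two {α F : Type*} [MeasurableSpace α] [NormedAddCommGroup F]
    (f : α → F) (μ : Measure α) : eLpNorm f 2 μ ^ 2 = ∫⁻ x, ‖f x‖ₑ ^ 2 ∂μ := by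
  have h := eLpNorm_nnreal_pow_eq_lintegral (f := f) (μ := μ) (p := 2) two_ne_zero
  simpa using h

theorem measurable_gradFun {n : ℕ} {Ω : Set (E n)} (hΩ : MeasurableSet Ω) {ω u : E n → ℝ}
    (hω : Measurable ω) (hu : Measurable u) : Measurable (gradFun Ω ω u) := by
  have hU := hu.indicator hΩ
  unfold gradFun
  fun_prop

theorem gradFun_eq_zero {n : ℕ} {Ω : Set (E n)} {δ : ℝ} {ω u : E n → ℝ}
    (hω : IsKernel δ ω) {z : E n × E n} (hz : z ∉ extDomain Ω δ ×ˢ extDomain Ω δ) :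
    gradFun Ω ω u z = 0 := by
  by_contra h
  rw [gradFun, mul_eq_zero, not_or] at h
  have hd : dist z.1 z.2 < δ := by
    have := hω.support_subset (Function.mem_support.2 h.2)
    rwa [mem_ball_zero_iff, ← dist_eq_norm] at this
  have hδ : 0 < δ := dist_nonneg.trans_lt hd
  refine hz ?_
  by_cases h1 : z.1 ∈ Ω
  · exact ⟨Metric.self_subset_thickening hδ _ h1,
      Metric.mem_thickening_iff.2 ⟨z.1, h1, by rwa [dist_comm]⟩⟩
  · by_cases h2 : z.2 ∈ Ω
    · exact ⟨Metric.mem_thickening_iff.2 ⟨z.2, h2, hd⟩, Metric.self_subset_thickening hδ _ h2⟩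
    · exact absurd (by simp [h1, h2]) h.1

/-- The energy `‖G_δ u‖²` is the integral of `ω(h)²` against the squared `L²(ℝⁿ)` norm of the
difference of `u` and its translate by `h`. -/
theorem sq_eLpNorm_gradFun {n : ℕ} {Ω : Set (E n)} (hΩ : MeasurableSet Ω) {δ : ℝ}
    {ω u : E n → ℝ} (hω : IsKernel δ ω) (hu : Measurable u) :
    eLpNorm (gradFun Ω ω u) 2 (pairMeasure Ω δ) ^ 2 =
      ∫⁻ h, ‖ω h‖ₑ ^ 2 *
        eLpNorm (fun x => Ω.indicator u (x + h) - Ω.indicator u x) 2 volume ^ 2 := by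
  have hU := hu.indicator hΩ
  have hωm := hω.measurable
  have hext : MeasurableSet (extDomain Ω δ) := Metric.isOpen_thickening.measurableSet
  have hG : Measurable (gradFun Ω ω u) := measurable_gradFun hΩ hωm hu
  rw [sq_eLpNorm_two, pairMeasure, Measure.prod_restrict,
    ← lintegral_indicator (hext.prod hext)]
  have h1 : (extDomain Ω δ ×ˢ extDomain Ω δ).indicator (fun z => ‖gradFun Ω ω u z‖ₑ ^ 2) =
      fun z => ‖gradFun Ω ω u z‖ₑ ^ 2 := by
    rw [indicator_eq_self]
    intro z hz
    by_contra h
    exact hz (by simp [gradFun_eq_zero (u := u) hω h])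
  rw [h1, lintegral_prod_symm _ (by fun_prop)]
  have h2 : ∀ y : E n, ∫⁻ x, ‖gradFun Ω ω u (x, y)‖ₑ ^ 2 =
      ∫⁻ h, ‖gradFun Ω ω u (h + y, y)‖ₑ ^ 2 := fun y =>
    (lintegral_add_right_eq_self (fun x => ‖gradFun Ω ω u (x, y)‖ₑ ^ 2) y).symm
  simp only [h2]
  rw [lintegral_lintegral_swap (by unfold Function.uncurry; fun_prop)]
  refine lintegral_congr fun h => ?_
  rw [sq_eLpNorm_two, ← lintegral_const_mul _ (by fun_prop)]
  refine lintegral_congr fun x => ?_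
  simp only [gradFun, add_comm h x, add_sub_cancel_left, enorm_mul, mul_pow]
  ring

/-! ### Density of the domain of the nonlocal gradient -/

theorem memLp_gradFun_of_lipschitz {n : ℕ} {Ω : Set (E n)} (hΩ : MeasurableSet Ω)
    (hb : Bornology.IsBounded Ω) (hn : 0 < n) {δ : ℝ}
    {ω g : E n → ℝ} (hω : IsKernel δ ω) (hg : Measurable g) {L : NNReal}
    (hL : LipschitzWith L (Ω.indicator g)) :
    MemLp (gradFun Ω ω g) 2 (pairMeasure Ω δ) := by
  have hωm := hω.measurable
  have hfin : volume (extDomain Ω δ) < ⊤ := hb.thickening.measure_lt_top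
  have hle : ∀ z : E n × E n, ‖gradFun Ω ω g z‖ₑ ^ 2 ≤
      (L : ENNReal) ^ 2 * (‖z.1 - z.2‖ₑ ^ 2 * ‖ω (z.1 - z.2)‖ₑ ^ 2) := fun z => by
    rw [gradFun, enorm_mul, ← mul_pow, ← mul_pow, ← mul_assoc]
    gcongr
    have := hL z.1 z.2
    rwa [edist_eq_enorm_sub, edist_eq_enorm_sub] at this
  refine ⟨(measurable_gradFun hΩ hωm hg).aestronglyMeasurable, ?_⟩
  have hsq : eLpNorm (gradFun Ω ω g) 2 (pairMeasure Ω δ) ^ 2 < ⊤ := by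
    rw [sq_eLpNorm_two]
    calc ∫⁻ z, ‖gradFun Ω ω g z‖ₑ ^ 2 ∂(pairMeasure Ω δ)
        ≤ ∫⁻ z, (L : ENNReal) ^ 2 * (‖z.1 - z.2‖ₑ ^ 2 * ‖ω (z.1 - z.2)‖ₑ ^ 2)
            ∂(pairMeasure Ω δ) := lintegral_mono hle
      _ = ∫⁻ x in extDomain Ω δ, ∫⁻ y in extDomain Ω δ,
            (L : ENNReal) ^ 2 * (‖x - y‖ₑ ^ 2 * ‖ω (x - y)‖ₑ ^ 2) := by
          rw [pairMeasure, lintegral_prod _ (by fun_prop)]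
      _ ≤ ∫⁻ x in extDomain Ω δ, ∫⁻ y,
            (L : ENNReal) ^ 2 * (‖x - y‖ₑ ^ 2 * ‖ω (x - y)‖ₑ ^ 2) :=
          lintegral_mono fun x => setLIntegral_le_lintegral _ _
      _ = ∫⁻ x in extDomain Ω δ, (L : ENNReal) ^ 2 * n := by
          refine lintegral_congr fun x => ?_
          rw [lintegral_sub_left_eq_self
            (fun y => (L : ENNReal) ^ 2 * (‖y‖ₑ ^ 2 * ‖ω y‖ₑ ^ 2)) x,
            lintegral_const_mul _ (by fun_prop), hω.lintegral_enorm_sq_mul_sq hn]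
      _ < ⊤ := by
          rw [setLIntegral_const]
          exact ENNReal.mul_lt_top
            (ENNReal.mul_lt_top (ENNReal.pow_lt_top ENNReal.coe_lt_top) (by simp)) hfin
  by_contra h
  simp [top_le_iff.1 (not_lt.1 h)] at hsq

theorem dense_gradDomain {n : ℕ} (hn : 0 < n) {Ω : Set (E n)} (hΩ : IsOpen Ω)
    (hb : Bornology.IsBounded Ω) {δ : ℝ} {ω : E n → ℝ} (hω : IsKernel δ ω) :
    Dense (gradDomain Ω δ ω : Set (L2 Ω)) := by
  rw [Submodule.dense_iff_topologicalClosure_eq_top, Submodule.topologicalClosure_eq_top_iff,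
    Submodule.eq_bot_iff]
  intro w hw
  have hloc : LocallyIntegrableOn w Ω (volume.restrict Ω) :=
    ((Lp.memLp w).locallyIntegrable one_le_two).locallyIntegrableOn _
  have key := hΩ.ae_eq_zero_of_integral_contDiff_smul_eq_zero hloc fun g hg hgc hgs => by
    have hgm : MemLp g 2 (volume.restrict Ω) :=
      hg.continuous.memLp_of_hasCompactSupport hgc
    have hind : Ω.indicator g = g := indicator_eq_self.2 ((subset_tsupport g).trans hgs)
    obtain ⟨L, hL⟩ := hg.lipschitzWith_of_hasCompactSupport hgc (by simp)
    have hmem : hgm.toLp g ∈ gradDomain Ω δ ω :=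
      mem_gradDomain.2 ((memLp_congr_ae (gradFun_congr δ ω hgm.coeFn_toLp)).2
        (memLp_gradFun_of_lipschitz hΩ.measurableSet hb hn hω hg.continuous.measurable
          (hind.symm ▸ hL)))
    have h0 := hw _ hmem
    rw [L2.inner_def] at h0
    rw [← h0]
    refine integral_congr_ae ?_
    filter_upwards [hgm.coeFn_toLp] with x hx
    rw [hx]
    simp [mul_comm]
  refine Lp.eq_zero_iff_ae_eq_zero.2 ?_
  filter_upwards [key, ae_restrict_mem hΩ.measurableSet] with x hx hxΩ using hx hxΩ

/-! ### The Poincaré inequality -/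

theorem eLpNorm_translate_nsmul_sub_le {n : ℕ} {U : E n → ℝ} (hU : Measurable U) (h : E n)
    (k : ℕ) : eLpNorm (fun x => U (x + k • h) - U x) 2 volume ≤
      k * eLpNorm (fun x => U (x + h) - U x) 2 volume := by
  induction k with
  | zero => simp
  | succ k ih =>
    have h1 : (fun x => U (x + (k + 1) • h) - U x) =
        (fun x => U (x + h) - U x) ∘ (fun x => x + k • h) + fun x => U (x + k • h) - U x := by
      funext x
      simp only [Pi.add_apply, Function.comp_apply, add_smul, one_smul, add_assoc,
        sub_add_sub_cancel]
    have hm : Measurable fun x => U (x + h) - U x := by fun_prop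
    have hm' : Measurable fun x => U (x + k • h) - U x := by fun_prop
    rw [h1]
    refine (eLpNorm_add_le (hm.comp (by fun_prop)).aestronglyMeasurable
      hm'.aestronglyMeasurable one_le_two).trans ?_
    rw [eLpNorm_comp_measurePreserving hm.aestronglyMeasurable
      (measurePreserving_add_right volume (k • h))]
    push_cast
    rw [add_mul, one_mul, add_comm]
    gcongr

/-- The translate of `Ω` by a vector longer than the diameter of `Ω` is disjoint from `Ω`. -/
theorem eLpNorm_le_eLpNorm_translate_sub {n : ℕ} {Ω : Set (E n)} {R : ℝ}
    (hR : ∀ x ∈ Ω, ∀ y ∈ Ω, dist x y ≤ R) (u : E n → ℝ) {h : E n} (hh : R < ‖h‖) :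
    eLpNorm (Ω.indicator u) 2 volume ≤
      eLpNorm (fun x => Ω.indicator u (x + h) - Ω.indicator u x) 2 volume := by
  refine eLpNorm_mono_enorm fun x => ?_
  by_cases hx : x ∈ Ω
  · have hxh : x + h ∉ Ω := fun hxh => by
      have := hR _ hxh _ hx
      rw [dist_eq_norm, add_sub_cancel_left] at this
      exact absurd this (not_le.2 hh)
    simp [hxh]
  · simp [hx]

theorem enorm_mul_eLpNorm_le_translate_sub {n : ℕ} {Ω : Set (E n)} (hΩ : MeasurableSet Ω)
    {R δ : ℝ} (hR0 : 0 ≤ R) (hR : ∀ x ∈ Ω, ∀ y ∈ Ω, dist x y ≤ R) {u : E n → ℝ}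
    (hu : Measurable u) {h : E n} (hh : ‖h‖ ≤ δ) :
    ‖h‖ₑ * eLpNorm (Ω.indicator u) 2 volume ≤ ENNReal.ofReal (R + δ) *
      eLpNorm (fun x => Ω.indicator u (x + h) - Ω.indicator u x) 2 volume := by
  rcases eq_or_ne h 0 with rfl | h0
  · simp
  have hpos : 0 < ‖h‖ := norm_pos_iff.2 h0
  -- the least number of steps `h` that add up to more than the diameter
  set k : ℕ := ⌊R / ‖h‖⌋₊ + 1 with hk
  have hk1 : R < k * ‖h‖ := by
    rw [← div_lt_iff₀ hpos, hk]
    exact_mod_cast Nat.lt_floor_add_one (R / ‖h‖)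
  have hk2 : k * ‖h‖ ≤ R + δ := by
    have := Nat.floor_le (div_nonneg hR0 hpos.le)
    rw [le_div_iff₀ hpos] at this
    rw [hk]
    push_cast
    linarith
  have h1 := (eLpNorm_le_eLpNorm_translate_sub hR u (h := k • h)
    (by rwa [← Nat.cast_smul_eq_nsmul ℝ, norm_smul, Real.norm_natCast])).trans
    (eLpNorm_translate_nsmul_sub_le (hu.indicator hΩ) h k)
  calc ‖h‖ₑ * eLpNorm (Ω.indicator u) 2 volume
      ≤ ‖h‖ₑ * (k * eLpNorm (fun x => Ω.indicator u (x + h) - Ω.indicator u x) 2 volume) := by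
        gcongr
    _ = ENNReal.ofReal (k * ‖h‖) *
          eLpNorm (fun x => Ω.indicator u (x + h) - Ω.indicator u x) 2 volume := by
        rw [ENNReal.ofReal_mul (by positivity), ENNReal.ofReal_natCast, ofReal_norm]
        ring
    _ ≤ _ := by gcongr

theorem norm_le_mul_norm_nlGrad {n : ℕ} (hn : 0 < n) {Ω : Set (E n)} (hΩ : IsOpen Ω)
    {R δ : ℝ} (hR0 : 0 ≤ R) (hδ : 0 < δ) (hR : ∀ x ∈ Ω, ∀ y ∈ Ω, dist x y ≤ R)
    {ω : E n → ℝ} (hω : IsKernel δ ω) (u : (nlGrad Ω δ ω).domain) :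
    ‖(u : L2 Ω)‖ ≤ (R + δ) * ‖nlGrad Ω δ ω u‖ := by
  have hωm := hω.measurable
  have hu : Measurable ((u : L2 Ω) : E n → ℝ) := (Lp.stronglyMeasurable _).measurable
  set v : E n → ℝ := ((u : L2 Ω) : E n → ℝ) with hv
  have hG : MemLp (gradFun Ω ω v) 2 (pairMeasure Ω δ) := mem_gradDomain.1 u.2
  have hnorm : ‖nlGrad Ω δ ω u‖ = (eLpNorm (gradFun Ω ω v) 2 (pairMeasure Ω δ)).toReal :=
    Lp.norm_toLp _ hG
  have hvn : eLpNorm (Ω.indicator v) 2 volume = eLpNorm v 2 (volume.restrict Ω) :=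
    eLpNorm_indicator_eq_eLpNorm_restrict hΩ.measurableSet
  have hsq : eLpNorm (Ω.indicator v) 2 volume ^ 2 ≤
      (ENNReal.ofReal (R + δ) * eLpNorm (gradFun Ω ω v) 2 (pairMeasure Ω δ)) ^ 2 := by
    calc eLpNorm (Ω.indicator v) 2 volume ^ 2
        ≤ n * eLpNorm (Ω.indicator v) 2 volume ^ 2 :=
          le_mul_of_one_le_left' (by exact_mod_cast hn)
      _ = ∫⁻ h, ‖ω h‖ₑ ^ 2 * (‖h‖ₑ * eLpNorm (Ω.indicator v) 2 volume) ^ 2 := by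
          rw [← hω.lintegral_enorm_sq_mul_sq hn, ← lintegral_mul_const _ (by fun_prop)]
          refine lintegral_congr fun h => ?_
          ring
      _ ≤ ∫⁻ h, ENNReal.ofReal (R + δ) ^ 2 * (‖ω h‖ₑ ^ 2 *
            eLpNorm (fun x => Ω.indicator v (x + h) - Ω.indicator v x) 2 volume ^ 2) := by
          refine lintegral_mono fun h => ?_
          by_cases hh : ω h = 0
          · simp [hh]
          have hball := hω.support_subset (Function.mem_support.2 hh)
          rw [mem_ball_zero_iff] at hball
          calc _ ≤ ‖ω h‖ₑ ^ 2 * (ENNReal.ofReal (R + δ) *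
                eLpNorm (fun x => Ω.indicator v (x + h) - Ω.indicator v x) 2 volume) ^ 2 := by
                refine mul_le_mul_right (pow_le_pow_left' ?_ 2) _
                exact enorm_mul_eLpNorm_le_translate_sub hΩ.measurableSet hR0 hR hu hball.le
            _ = _ := by ring
      _ = _ := by
          rw [lintegral_const_mul' _ _ (by finiteness), mul_pow,
            sq_eLpNorm_gradFun hΩ.measurableSet hω hu]
  have hle := (ENNReal.pow_le_pow_left_iff two_ne_zero).1 hsq
  rw [hvn] at hle
  rw [hnorm, Lp.norm_def, ← ENNReal.toReal_ofReal (add_nonneg hR0 hδ.le), ← ENNReal.toReal_mul]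
  exact ENNReal.toReal_mono (ENNReal.mul_ne_top ENNReal.ofReal_ne_top hG.2.ne) hle

/-! ### Multiplication by a bounded function -/

/-- Multiplication by an a.e. bounded measurable function, as a bounded operator on `L²`. -/
theorem exists_mulL2 {α : Type*} [MeasurableSpace α] {μ : Measure α} {m : α → ℝ}
    (hm : AEMeasurable m μ) {c : ℝ} (hmc : ∀ᵐ x ∂μ, ‖m x‖ ≤ c) :
    ∃ A : Lp ℝ 2 μ →L[ℝ] Lp ℝ 2 μ, (∀ g, A g =ᵐ[μ] fun x => m x * g x) ∧
      ∀ g, ‖A g‖ ≤ c * ‖g‖ := by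
  have hle : ∀ g : Lp ℝ 2 μ, ∀ᵐ x ∂μ, ‖m x * g x‖ ≤ c * ‖g x‖ := fun g => by
    filter_upwards [hmc] with x hx
    rw [norm_mul]
    gcongr
  have hmem : ∀ g : Lp ℝ 2 μ, MemLp (fun x => m x * g x) 2 μ := fun g =>
    (Lp.memLp g).of_le_mul (hm.mul (Lp.aestronglyMeasurable g).aemeasurable).aestronglyMeasurable
      (hle g)
  have hco := fun g => (hmem g).coeFn_toLp
  let A₀ : Lp ℝ 2 μ →ₗ[ℝ] Lp ℝ 2 μ :=
    { toFun := fun g => (hmem g).toLp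
      map_add' := fun g h => by
        refine Lp.ext ?_
        filter_upwards [hco (g + h), Lp.coeFn_add g h, hco g, hco h,
          Lp.coeFn_add ((hmem g).toLp) ((hmem h).toLp)] with x h1 h2 h3 h4 h5
        rw [h1, h5, h2, Pi.add_apply, Pi.add_apply, h3, h4, mul_add]
      map_smul' := fun a g => by
        refine Lp.ext ?_
        filter_upwards [hco (a • g), Lp.coeFn_smul a g, hco g,
          Lp.coeFn_smul a ((hmem g).toLp)] with x h1 h2 h3 h4
        rw [h1, RingHom.id_apply, h4, h2, Pi.smul_apply, Pi.smul_apply, h3, smul_eq_mul,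
          smul_eq_mul, mul_left_comm] }
  have hA : ∀ g, A₀ g =ᵐ[μ] fun x => m x * g x := hco
  have hAn : ∀ g, ‖A₀ g‖ ≤ c * ‖g‖ := fun g => by
    refine Lp.norm_le_mul_norm_of_ae_le_mul ?_
    filter_upwards [hA g, hle g] with x h1 h2
    rwa [h1]
  exact ⟨A₀.mkContinuous c hAn, hA, hAn⟩

theorem integral_mul_eq_inner {α : Type*} [MeasurableSpace α] {μ : Measure α}
    (f g : Lp ℝ 2 μ) : ∫ x, f x * g x ∂μ = inner ℝ f g := by
  rw [L2.inner_def]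
  simp [mul_comm]

/-- A lower bound `c ≤ m` for the multiplier makes the multiplication form coercive. -/
theorem mul_norm_sq_le_inner {α : Type*} [MeasurableSpace α] {μ : Measure α} {m : α → ℝ}
    {c : ℝ} (hmc : ∀ᵐ x ∂μ, c ≤ m x) {g h : Lp ℝ 2 μ} (hh : h =ᵐ[μ] fun x => m x * g x) :
    c * ‖g‖ ^ 2 ≤ inner ℝ h g := by
  rw [← real_inner_self_eq_norm_sq, ← real_inner_smul_left, L2.inner_def, L2.inner_def]
  refine integral_mono_ae (L2.integrable_inner _ _) (L2.integrable_inner _ _) ?_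
  filter_upwards [hmc, hh, Lp.coeFn_smul c g] with x h1 h2 h3
  simp only [h2, h3, Pi.smul_apply, smul_eq_mul, RCLike.inner_apply, conj_trivial]
  nlinarith [mul_self_nonneg (g x)]

/-! ### The mixed problem -/

theorem formB_eq {n : ℕ} {Ω : Set (E n)} {δ : ℝ} {ω : E n → ℝ} (p : FluxSpace Ω δ ω)
    (v : L2 Ω) : formB p v = -inner ℝ (nlDiv Ω δ ω p) v := by
  rw [formB, integral_mul_eq_inner]

/-- The balance equation of the mixed problem says that `D_δ q = f`. -/
theorem IsMixedSolution.nlDiv_eq {n : ℕ} {Ω : Set (E n)} {δ : ℝ} {ω : E n → ℝ}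
    {κ : E n × E n → ℝ} {f : L2 Ω} {s : FluxSpace Ω δ ω × L2 Ω} (hs : IsMixedSolution κ f s) :
    nlDiv Ω δ ω s.1 = f := by
  refine ext_inner_right ℝ fun v => ?_
  have := hs.2 v
  rwa [formB_eq, load, integral_mul_eq_inner, neg_inj] at this

/-- A conductivity `κ` acts on `L²(Ω_δ × Ω_δ)` by a bounded coercive multiplication operator `A`,
and the form `∬ κ⁻¹ q p` is that of a bounded coercive inverse `B` of `A`. -/
theorem IsConductivity.exists_operators {n : ℕ} {Ω : Set (E n)} {δ κlo κhi : ℝ}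
    {κ : E n × E n → ℝ} (hκ : IsConductivity Ω δ κlo κhi κ) (hlo : 0 < κlo)
    (ω : E n → ℝ) :
    ∃ A B : L2Pair Ω δ →L[ℝ] L2Pair Ω δ,
      (∀ g, B (A g) = g) ∧ (∀ g, ‖A g‖ ≤ κhi * ‖g‖) ∧
      (∀ g, κlo * ‖g‖ ^ 2 ≤ inner ℝ (A g) g) ∧
      (∀ g, κhi⁻¹ * ‖g‖ ^ 2 ≤ inner ℝ (B g) g) ∧
      ∀ q p : FluxSpace Ω δ ω, formA κ q p = inner ℝ (B q) (p : L2Pair Ω δ) := by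
  obtain ⟨A, hA, hAn⟩ := exists_mulL2 hκ.aemeasurable
    (hκ.mem_Icc.mono fun z hz => by
      rw [Real.norm_of_nonneg (hlo.le.trans hz.1)]; exact hz.2)
  obtain ⟨B, hB, -⟩ := exists_mulL2 hκ.aemeasurable.inv (c := κlo⁻¹)
    (hκ.mem_Icc.mono fun z hz => by
      have := hz.1
      rw [Pi.inv_apply, norm_inv, Real.norm_of_nonneg (hlo.le.trans hz.1)]
      gcongr)
  refine ⟨A, B, fun g => Lp.ext ?_, hAn,
    fun g => mul_norm_sq_le_inner (hκ.mem_Icc.mono fun z hz => hz.1) (hA g),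
    fun g => mul_norm_sq_le_inner (hκ.mem_Icc.mono fun z hz => ?_) (hB g), fun q p => ?_⟩
  · filter_upwards [hA g, hB (A g), hκ.mem_Icc] with z h1 h2 h3
    rw [h2, h1, Pi.inv_apply, inv_mul_cancel_left₀ (hlo.trans_le h3.1).ne']
  · have h0 := hlo.trans_le hz.1
    have := hz.2
    rw [Pi.inv_apply]
    gcongr
  · rw [← integral_mul_eq_inner]
    refine integral_congr_ae ?_
    filter_upwards [hB q] with z hz
    rw [hz, Pi.inv_apply]

/-- The mixed problem is well posed, with explicit bounds, as soon as the nonlocal gradient is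
densely defined and satisfies a Poincaré inequality with constant `c`. -/
theorem exists_unique_mixedSolution {n : ℕ} {Ω : Set (E n)} {δ κlo κhi c : ℝ} {ω : E n → ℝ}
    {κ : E n × E n → ℝ} (hκ : IsConductivity Ω δ κlo κhi κ) (hlo : 0 < κlo) (hhi : κlo < κhi)
    (hd : Dense ((nlGrad Ω δ ω).domain : Set (L2 Ω))) (hc : 0 ≤ c)
    (hP : ∀ u : (nlGrad Ω δ ω).domain, ‖(u : L2 Ω)‖ ≤ c * ‖nlGrad Ω δ ω u‖) (f : L2 Ω) :
    ∃ s : FluxSpace Ω δ ω × L2 Ω, IsMixedSolution κ f s ∧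
      (∀ s', IsMixedSolution κ f s' → s' = s) ∧
      ‖(s.1 : L2Pair Ω δ)‖ ≤ κhi * (c / κlo * ‖f‖) ∧ ‖nlDiv Ω δ ω s.1‖ = ‖f‖ ∧
      ‖s.2‖ ≤ c * (c / κlo * ‖f‖) := by
  have hhi0 := hlo.trans hhi
  obtain ⟨A, B, hBA, hAn, hA, hB, hform⟩ := hκ.exists_operators hlo ω
  set G := nlGrad Ω δ ω with hG
  have hsolve : ∀ f : L2 Ω, ∃ s : FluxSpace Ω δ ω × L2 Ω, IsMixedSolution κ f s ∧
      ‖(s.1 : L2Pair Ω δ)‖ ≤ κhi * (c / κlo * ‖f‖) ∧ ‖s.2‖ ≤ c * (c / κlo * ‖f‖) := by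
    intro f
    obtain ⟨g, u, hg, hu, hun, hgn⟩ := exists_solution_of_poincare G hd hc hP A hlo hA f
    have hgn' : ‖g‖ ≤ c / κlo * ‖f‖ := by
      rw [div_mul_eq_mul_div, le_div_iff₀ hlo]
      linarith
    have hw : ∀ v : G.domain, inner ℝ (-f) (v : L2 Ω) = inner ℝ (-(A g)) (G v) := fun v => by
      rw [inner_neg_left, inner_neg_left, hg v]
    -- the flux is `q = -κ G u`, with `g` in place of `G u`
    let q : FluxSpace Ω δ ω := ⟨-(A g), G.mem_adjoint_domain_of_exists _ ⟨-f, hw⟩⟩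
    have hq : nlDiv Ω δ ω q = f := by
      have h2 : nlDiv Ω δ ω q = -G.adjoint q := LinearPMap.neg_apply _ _
      rw [h2, LinearPMap.adjoint_apply_eq hd q hw, neg_neg]
    refine ⟨(q, u), ⟨fun p => ?_, fun v => ?_⟩, ?_, ?_⟩
    · have h1 : B (q : L2Pair Ω δ) = -g := by
        change B (-(A g)) = -g
        rw [map_neg, hBA]
      have h2 : nlDiv Ω δ ω p = -G.adjoint p := LinearPMap.neg_apply _ _
      rw [hform, formB_eq, h1, h2, inner_neg_left, inner_neg_left, neg_neg, ← hu p,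
        real_inner_comm, neg_add_cancel]
    · rw [formB_eq, load, integral_mul_eq_inner, hq]
    · change ‖-(A g)‖ ≤ _
      rw [norm_neg]
      exact (hAn g).trans (by gcongr)
    · exact hun.trans (by gcongr)
  obtain ⟨s, hs, hs1, hs2⟩ := hsolve f
  refine ⟨s, hs, fun s' hs' => ?_, hs1, by rw [hs.nlDiv_eq], hs2⟩
  have hdiv : nlDiv Ω δ ω (s'.1 - s.1) = 0 := by
    rw [LinearPMap.map_sub, hs'.nlDiv_eq, hs.nlDiv_eq, sub_self]
  have hdiff : ∀ p : FluxSpace Ω δ ω, inner ℝ (B (s'.1 - s.1 : L2Pair Ω δ)) (p : L2Pair Ω δ) =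
      inner ℝ (nlDiv Ω δ ω p) (s'.2 - s.2) := fun p => by
    have h1 := hs'.1 p
    have h2 := hs.1 p
    rw [hform, formB_eq] at h1 h2
    rw [map_sub, inner_sub_left, inner_sub_right]
    linarith
  -- testing with `p = q' - q` gives equality of the fluxes
  have hq : s'.1 = s.1 := by
    have h1 := hdiff (s'.1 - s.1)
    rw [hdiv, inner_zero_left] at h1
    have h2 := hB (s'.1 - s.1 : L2Pair Ω δ)
    have h3 : inner ℝ (B (s'.1 - s.1 : L2Pair Ω δ)) (s'.1 - s.1 : L2Pair Ω δ) = 0 := h1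
    rw [h3] at h2
    have h4 : ‖(s'.1 - s.1 : L2Pair Ω δ)‖ ^ 2 ≤ 0 :=
      nonpos_of_mul_nonpos_right h2 (inv_pos.2 hhi0)
    refine Subtype.ext (sub_eq_zero.1 (norm_eq_zero.1 ?_))
    exact pow_eq_zero_iff two_ne_zero |>.1 (le_antisymm h4 (sq_nonneg _))
  -- since the divergence is onto, it then gives equality of the potentials
  have hu : s'.2 = s.2 := by
    obtain ⟨t, ht, -⟩ := hsolve (s'.2 - s.2)
    have h1 := hdiff t.1
    rw [hq, sub_self, map_zero, inner_zero_left, ht.nlDiv_eq] at h1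
    exact sub_eq_zero.1 (inner_self_eq_zero.1 h1.symm)
  exact Prod.ext hq hu

end NonlocalKelvin

theorem mainTheorem2 {n : ℕ} (hn : 2 ≤ n) (Ω : Set (NonlocalKelvin.E n))
    (hΩ : NonlocalKelvin.IsLipschitzDomain Ω)
    (κlo κhi : ℝ) (hκlo : 0 < κlo) (hκ : κlo < κhi)
    (δbar : ℝ) (hδbar : 0 < δbar)
    (ω : ℝ → NonlocalKelvin.E n → ℝ)
    (hω : ∀ δ ∈ Set.Ioo 0 δbar, NonlocalKelvin.IsKernel δ (ω δ)) :
    ∃ C : ℝ, 0 < C ∧ ∀ δ ∈ Set.Ioo 0 δbar,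
      ∀ κ : NonlocalKelvin.E n × NonlocalKelvin.E n → ℝ,
        NonlocalKelvin.IsConductivity Ω δ κlo κhi κ →
        ∀ f : NonlocalKelvin.L2 Ω,
          ∃ s : NonlocalKelvin.FluxSpace Ω δ (ω δ) × NonlocalKelvin.L2 Ω,
            NonlocalKelvin.IsMixedSolution κ f s ∧
            (∀ s' : NonlocalKelvin.FluxSpace Ω δ (ω δ) × NonlocalKelvin.L2 Ω,
              NonlocalKelvin.IsMixedSolution κ f s' → s' = s) ∧
            NonlocalKelvin.fluxNorm s.1 + ‖s.2‖ ≤ C * ‖f‖ := by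
  have hn0 : 0 < n := by lia
  obtain ⟨R, hR⟩ := Metric.isBounded_iff.1 hΩ.isBounded
  obtain ⟨x₀, hx₀⟩ := hΩ.isConnected.nonempty
  have hR0 : 0 ≤ R := dist_nonneg.trans (hR hx₀ hx₀)
  have hκhi : 0 < κhi := hκlo.trans hκ
  set c := R + δbar with hc
  have hc0 : 0 < c := by positivity
  refine ⟨κhi * (c / κlo) + 1 + c * (c / κlo), by positivity, fun δ hδ κ hcond f => ?_⟩
  have hker := hω δ hδ
  obtain ⟨s, hs, huniq, h1, h2, h3⟩ := NonlocalKelvin.exists_unique_mixedSolution hcond hκlo hκ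
    (NonlocalKelvin.dense_gradDomain hn0 hΩ.isOpen hΩ.isBounded hker) hc0.le
    (fun u => (NonlocalKelvin.norm_le_mul_norm_nlGrad hn0 hΩ.isOpen hR0 hδ.1
      (fun x hx y hy => hR hx hy) hker u).trans (by
        rw [hc]
        have := hδ.2
        gcongr)) f
  refine ⟨s, hs, huniq, ?_⟩
  have h4 : NonlocalKelvin.fluxNorm s.1 ≤ κhi * (c / κlo * ‖f‖) + ‖f‖ := by
    rw [NonlocalKelvin.fluxNorm, h2]
    refine (Real.sqrt_le_sqrt ?_).trans_eq (Real.sqrt_sq (by positivity))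
    have := pow_le_pow_left₀ (norm_nonneg _) h1 2
    have h5 : 0 ≤ κhi * (c / κlo * ‖f‖) := by positivity
    nlinarith [norm_nonneg f]
  linarith
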